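/- Let $\Gamma$ be a finite connected undirected simple graph with $n$ vertices, and let $e=\{v,w\}$ be a cycle-edge of $\Gamma$, i.e. an edge that is not a bridge. Let $\Gamma'_e$ be the graph obtained from $\Gamma$ by deleting $e$, and let $\Gamma''_e$ be the simple graph obtained from $\Gamma$ by contracting $e$ (identify $v$ and $w$, drop the resulting loop, merge parallel edges). For a graph $G$ let $\mathsf{Acyc}(G)$ be its set of acyclic orientations, and let $\sim_\kappa$ be the equivalence relation on $\mathsf{Acyc}(G)$ generated by clicks, a click being the conversion of a source into a sink by reversing all edges at it; write $[O]$ for the $\kappa$-class of $O$. A permutation $\pi=\pi_1\pi_2\cdots\pi_n$ of the vertices of $\Gamma$ induces $O^\pi_\Gamma\in\mathsf{Acyc}(\Gamma)$, in which each edge is oriented from the vertex that comes first in $\pi$ to the one that comes later. Let $O^\pi_{\Gamma'}$ be the orientation that $O^\pi_\Gamma$ induces on $\Gamma'_e$, and let $O^\pi_{\Gamma''}$ be the orientation that it induces on $\Gamma''_e$ (when this exists and is acyclic; it does when $\pi_1=v$ and $\pi_2=w$). For a $\kappa$-class $c\in\mathsf{Acyc}(\Gamma)/\!\sim_\kappa$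 choose a permutation $\pi$ with $[O^\pi_\Gamma]=c$ and $\pi_1=v$ in which the position of $w$ is minimal among all such permutations, and put $$\Theta(c)=\begin{cases}[O^\pi_{\Gamma''}], & \text{if } c=[O^\sigma_\Gamma]\text{ for some permutation }\sigma=vw\sigma_3\cdots\sigma_n,\\ [O^\pi_{\Gamma'}], & \text{otherwise.}\end{cases}$$ Then such a $\pi$ exists for every $c$, the value $\Theta(c)$ is defined and does not depend on the choice of $\pi$, and $$\Theta\colon \mathsf{Acyc}(\Gamma)/\!\sim_\kappa\;\longrightarrow\;\bigl(\mathsf{Acyc}(\Gamma'_e)/\!\sim_\kappa\bigr)\,\sqcup\,\bigl(\mathsf{Acyc}(\Gamma''_e)/\!\sim_\kappa\bigr)$$ is a bijection onto the disjoint union. -/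

import Mathlib

namespace ClickBijection

/-- An orientation of the simple graph `Γ`, viewed as a directed graph: `Arc a b` says that
`{a, b}` is an edge of `Γ` and that it is oriented as `(a, b)`. -/
@[ext]
structure GraphOrientation {V : Type*} (Γ : SimpleGraph V) where
  Arc : V → V → Prop
  adj_iff : ∀ a b, Γ.Adj a b ↔ (Arc a b ∨ Arc b a)
  asymm : ∀ a b, Arc a b → ¬ Arc b a

/-- There is no directed closed walk of positive length. -/
def GraphOrientation.IsAcyclic {V : Type*} {Γ : SimpleGraph V} (O : GraphOrientation Γ) : Prop :=
  ∀ a, ¬ Relation.TransGen O.Arc a a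

/-- The set of acyclic orientations of `Γ`. -/
def Acyc {V : Type*} (Γ : SimpleGraph V) : Type _ :=
  {O : GraphOrientation Γ // O.IsAcyclic}

/-- A source: a vertex without incoming arcs. -/
def GraphOrientation.IsSource {V : Type*} {Γ : SimpleGraph V} (O : GraphOrientation Γ)
    (x : V) : Prop :=
  ∀ a, ¬ O.Arc a x

/-- The orientation obtained from `O` by reversing exactly the edges incident with `x`. -/
def GraphOrientation.reverseAt {V : Type*} {Γ : SimpleGraph V} (O : GraphOrientation Γ)
    (x : V) : GraphOrientation Γ where
  Arc a b := ((a ≠ x ∧ b ≠ x) ∧ O.Arc a b) ∨ ((a = x ∨ b = x) ∧ O.Arc b a)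
  adj_iff a b := by
    have := O.adj_iff a b
    tauto
  asymm a b := by
    have h₁ := O.asymm a b
    have h₂ := O.asymm b a
    tauto

/-- `O'` is obtained from `O` by one click, that is, by converting a source into a sink. -/
def IsClick {V : Type*} {Γ : SimpleGraph V} (O O' : Acyc Γ) : Prop :=
  ∃ x, O.1.IsSource x ∧ O'.1 = O.1.reverseAt x

/-- `κ`-equivalence: the equivalence relation on acyclic orientations generated by clicks. -/
def kappaSetoid {V : Type*} (Γ : SimpleGraph V) : Setoid (Acyc Γ) :=
  Relation.EqvGen.setoid IsClick

/-- The set of `κ`-classes of acyclic orientations of `Γ`. -/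
def KappaClass {V : Type*} (Γ : SimpleGraph V) : Type _ :=
  Quotient (kappaSetoid Γ)

/-- The `κ`-class of an acyclic orientation. -/
def kappaClass {V : Type*} {Γ : SimpleGraph V} (O : Acyc Γ) : KappaClass Γ :=
  Quotient.mk (kappaSetoid Γ) O

/-- A permutation (total order) of the vertex set, given by the position `π x` of each vertex;
positions are counted from `0`. -/
abbrev VertexOrder (V : Type*) [Fintype V] : Type _ :=
  V ≃ Fin (Fintype.card V)

/-- The acyclic orientation induced by a total order of the vertices: every edge is oriented
from the earlier to the later vertex. -/
def ofOrder {V : Type*} [Fintype V] (Γ : SimpleGraph V) (π : VertexOrder V) : Acyc Γ where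
  val :=
    { Arc := fun a b => Γ.Adj a b ∧ π a < π b
      adj_iff := fun a b => by
        constructor
        · intro h
          rcases lt_or_gt_of_ne (fun hab => h.ne (π.injective hab)) with h' | h'
          · exact Or.inl ⟨h, h'⟩
          · exact Or.inr ⟨h.symm, h'⟩
        · rintro (h | h)
          · exact h.1
          · exact h.1.symm
      asymm := fun a b h h' => lt_asymm h.2 h'.2 }
  property := by
    intro a h
    have key : ∀ b, Relation.TransGen (fun a b => Γ.Adj a b ∧ π a < π b) a b → π a < π b := by
      intro b hb
      induction hb with
      | single h => exact h.2
      | tail _ h ih => exact ih.trans h.2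
    exact lt_irrefl _ (key a h)

/-- The edge `{v, w}` of `Γ` is a cycle-edge: an edge that is not a bridge. -/
def IsCycleEdge {V : Type*} (Γ : SimpleGraph V) (v w : V) : Prop :=
  Γ.Adj v w ∧ ¬ Γ.IsBridge s(v, w)

/-- The graph obtained from `Γ` by deleting the edge `{v, w}`. -/
abbrev deletion {V : Type*} (Γ : SimpleGraph V) (v w : V) : SimpleGraph V :=
  Γ.deleteEdges {s(v, w)}

/-- The orientation of the deletion induced by an acyclic orientation of `Γ`. -/
def deleteOrientation {V : Type*} {Γ : SimpleGraph V} (v w : V) (O : Acyc Γ) :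
    Acyc (deletion Γ v w) where
  val :=
    { Arc := fun a b => O.1.Arc a b ∧ s(a, b) ≠ s(v, w)
      adj_iff := fun a b => by
        have h := O.1.adj_iff a b
        rw [SimpleGraph.deleteEdges_adj, Set.mem_singleton_iff, h, Sym2.eq_swap (a := b) (b := a)]
        tauto
      asymm := fun a b h h' => O.1.asymm a b h.1 h'.1 }
  property := fun a h => O.2 a (Relation.TransGen.mono (fun _ _ h' => h'.1) a a h)

/-- The equivalence relation on vertices that identifies `v` and `w` and nothing else. -/
def contractionSetoid {V : Type*} (v w : V) : Setoid V where
  r a b := a = b ∨ ((a = v ∨ a = w) ∧ (b = v ∨ b = w))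
  iseqv :=
    { refl := fun _ => Or.inl rfl
      symm := fun h => h.imp Eq.symm And.symm
      trans := fun {a b c} h h' => by
        rcases h with rfl | h
        · exact h'
        · rcases h' with rfl | h'
          · exact Or.inr h
          · exact Or.inr ⟨h.1, h'.2⟩ }

/-- The vertex set of the contraction. -/
abbrev ContractionVertex {V : Type*} (v w : V) : Type _ :=
  Quotient (contractionSetoid v w)

/-- The (simple) graph obtained from `Γ` by contracting the edge `{v, w}`: the vertices `v` and
`w` are identified, the edge `{v, w}` disappears, and parallel edges are merged. -/
def contraction {V : Type*} (Γ : SimpleGraph V) (v w : V) :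
    SimpleGraph (ContractionVertex v w) where
  Adj A B := A ≠ B ∧ ∃ a b, Quotient.mk _ a = A ∧ Quotient.mk _ b = B ∧ Γ.Adj a b
  symm := ⟨fun _ _ ⟨hne, a, b, ha, hb, h⟩ => ⟨hne.symm, b, a, hb, ha, h.symm⟩⟩
  loopless := ⟨fun _ h => h.1 rfl⟩

/-- `O''` is the orientation of the contraction induced by the orientation `O` of `Γ`: its arcs
are exactly the images of the arcs of `O` other than the arc on `{v, w}`. (Not every acyclic
orientation `O` has an induced acyclic orientation of the contraction.) -/
def IsContractionOf {V : Type*} {Γ : SimpleGraph V} {v w : V}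
    (O'' : Acyc (contraction Γ v w)) (O : Acyc Γ) : Prop :=
  ∀ A B, O''.1.Arc A B ↔
    (A ≠ B ∧ ∃ a b, Quotient.mk _ a = A ∧ Quotient.mk _ b = B ∧ O.1.Arc a b)

/-- `π = v π₂ ⋯ πₙ` represents the `κ`-class `c` and the position of `w` in it is minimal among
all such representatives of `c`. -/
def IsDistinguished {V : Type*} [Fintype V] {Γ : SimpleGraph V} (v w : V)
    (c : KappaClass Γ) (π : VertexOrder V) : Prop :=
  kappaClass (ofOrder Γ π) = c ∧ (π v : ℕ) = 0 ∧
    ∀ σ : VertexOrder V, kappaClass (ofOrder Γ σ) = c → (σ v : ℕ) = 0 → π w ≤ σ w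

/-- The `κ`-class `c` contains the orientation induced by some `π = v w π₃ ⋯ πₙ`. -/
def HasConsecutive {V : Type*} [Fintype V] {Γ : SimpleGraph V} (v w : V)
    (c : KappaClass Γ) : Prop :=
  ∃ π : VertexOrder V, kappaClass (ofOrder Γ π) = c ∧ (π v : ℕ) = 0 ∧ (π w : ℕ) = 1

/-- `IsThetaValue v w c d`: for some choice of the distinguished representative `π` of `c`, the
rule defining `Θ` assigns `d` to `c`. The rule sends `c` to the class of the orientation that
`π` induces on the contraction if `c` contains an orientation given by some `v w π₃ ⋯ πₙ`, and
to the class of the orientation that `π` induces on the deletion otherwise. -/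
def IsThetaValue {V : Type*} [Fintype V] {Γ : SimpleGraph V} (v w : V) (c : KappaClass Γ)
    (d : KappaClass (deletion Γ v w) ⊕ KappaClass (contraction Γ v w)) : Prop :=
  ∃ π : VertexOrder V, IsDistinguished v w c π ∧
    ((HasConsecutive v w c ∧
        ∃ O'' : Acyc (contraction Γ v w),
          IsContractionOf O'' (ofOrder Γ π) ∧ d = Sum.inr (kappaClass O'')) ∨
      (¬ HasConsecutive v w c ∧
        d = Sum.inl (kappaClass (deleteOrientation v w (ofOrder Γ π)))))

end ClickBijection

namespace ClickBijection

/-! Record a sequence of clicks by how often each vertex is clicked, inverse clicks counting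
negatively. This gives an integer potential that is constant along kept arcs and drops by one, tail
to head, along reversed ones. Two acyclic orientations are `κ`-equivalent exactly when such a
potential exists (`kappaClass_eq_iff`), so the theorem becomes a comparison of potentials on `Γ`,
the deletion and the contraction.

Orders starting with `v` orient the edge as `(v, w)`, so a potential `h` between two of them has `h
v = h w`. Such potentials are exactly those that descend to the contraction
(`kappaClass_contraction_eq_iff`), which matches the classes containing an order `v w ⋯` with the
classes of the contraction.

Any other class has, in each of its orders starting with `v`, a second directed path from `v` to `w`
(`exists_path_of_not_hasConsecutive`), and such a path excludes `v w ⋯`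
(`not_hasConsecutive_of_path`). These paths force `h v = h w` for a potential on the deletion, so it
lifts to `Γ` and `Θ` is injective there. For surjectivity, `w` stays connected to `v` in the
deletion, and each class of the deletion has a representative with a directed path from `v` to `w`
(`exists_reachable_along_arcs`). -/

variable {V : Type*} {Γ : SimpleGraph V}

/-! ### Potentials and `κ`-equivalence -/

/-- `h` counts clicks leading from `O` to `O'`: an arc of `O` is kept when its ends are clicked
equally often, and reversed when its tail is clicked once more than its head. -/
def IsPotential (O O' : Acyc Γ) (h : V → ℤ) : Prop :=
  ∀ a b, O.1.Arc a b → (O'.1.Arc a b ∧ h a = h b) ∨ (O'.1.Arc b a ∧ h a = h b + 1)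

lemma arc_or_arc (O O' : Acyc Γ) {a b : V} (h : O.1.Arc a b) : O'.1.Arc a b ∨ O'.1.Arc b a :=
  (O'.1.adj_iff a b).1 ((O.1.adj_iff a b).2 (Or.inl h))

lemma IsPotential.refl (O : Acyc Γ) : IsPotential O O 0 :=
  fun _ _ h => Or.inl ⟨h, rfl⟩

lemma IsPotential.symm {O O' : Acyc Γ} {h : V → ℤ} (H : IsPotential O O' h) :
    IsPotential O' O (-h) := by
  intro a b hab
  have h₁ := O'.1.asymm a b hab
  rcases arc_or_arc O' O hab with h₂ | h₂
  · rcases H _ _ h₂ with h₃ | h₃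
    · exact Or.inl ⟨h₂, by simp [h₃.2]⟩
    · exact absurd h₃.1 h₁
  · rcases H _ _ h₂ with h₃ | h₃
    · exact absurd h₃.1 h₁
    · exact Or.inr ⟨h₂, by simp [h₃.2]⟩

lemma IsPotential.trans {O O' O'' : Acyc Γ} {h h' : V → ℤ} (H : IsPotential O O' h)
    (H' : IsPotential O' O'' h') : IsPotential O O'' (h + h') := by
  intro a b hab
  simp only [Pi.add_apply]
  rcases H _ _ hab with ⟨h₁, e₁⟩ | ⟨h₁, e₁⟩ <;> rcases H' _ _ h₁ with ⟨h₂, e₂⟩ | ⟨h₂, e₂⟩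
  · exact Or.inl ⟨h₂, by omega⟩
  · exact Or.inr ⟨h₂, by omega⟩
  · exact Or.inr ⟨h₂, by omega⟩
  · exact Or.inl ⟨h₂, by omega⟩

lemma IsPotential.add_const {O O' : Acyc Γ} {h : V → ℤ} (H : IsPotential O O' h) (k : ℤ) :
    IsPotential O O' (fun x => h x + k) := by
  intro a b hab
  dsimp only
  rcases H _ _ hab with h₁ | h₁
  · exact Or.inl ⟨h₁.1, by omega⟩
  · exact Or.inr ⟨h₁.1, by omega⟩

lemma ext_of_arc {O O' : Acyc Γ} (h : ∀ a b, O.1.Arc a b → O'.1.Arc a b) : O = O' := by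
  apply Subtype.ext
  ext a b
  refine ⟨h a b, fun hab => ?_⟩
  rcases arc_or_arc O' O hab with h₁ | h₁
  · exact h₁
  · exact absurd (h _ _ h₁) (O'.1.asymm a b hab)

/-- Reversing the edges at a source keeps an orientation acyclic. -/
lemma isAcyclic_reverseAt (O : Acyc Γ) {x : V} (hx : O.1.IsSource x) :
    (O.1.reverseAt x).IsAcyclic := by
  have hout : ∀ b, ¬ (O.1.reverseAt x).Arc x b := by
    rintro b (⟨⟨h, -⟩, -⟩ | ⟨-, h⟩)
    · exact h rfl
    · exact hx b h
  -- The vertex `x` is now a sink, so a walk that does not end at `x` avoids it and uses only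
  -- unreversed arcs.
  have key : ∀ a b, Relation.TransGen (O.1.reverseAt x).Arc a b → b ≠ x →
      Relation.TransGen O.1.Arc a b := by
    intro a b hab
    induction hab with
    | @single b h =>
      intro hb
      rcases h with h | ⟨rfl | rfl, h⟩
      · exact .single h.2
      · exact absurd h (hx b)
      · exact absurd rfl hb
    | @tail b c h₁ h₂ ih =>
      intro hc
      rcases h₂ with h | ⟨rfl | rfl, h⟩
      · exact (ih h.1.1).tail h.2
      · exact absurd h (hx c)
      · exact absurd rfl hc
  intro a h
  by_cases ha : a = x
  · subst ha
    obtain ⟨b, hb, -⟩ := Relation.TransGen.head'_iff.1 h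
    exact hout b hb
  · exact O.2 a (key a a h ha)

lemma isPotential_of_isClick {O O' : Acyc Γ} (h : IsClick O O') : ∃ h, IsPotential O O' h := by
  classical
  obtain ⟨x, hx, e⟩ := h
  refine ⟨fun y => if y = x then 1 else 0, fun a b hab => ?_⟩
  have hb : b ≠ x := fun h => hx a (h ▸ hab)
  rw [e]
  by_cases ha : a = x
  · exact Or.inr ⟨Or.inr ⟨Or.inr ha, hab⟩, by simp [ha, hb]⟩
  · exact Or.inl ⟨Or.inl ⟨⟨ha, hb⟩, hab⟩, by simp [ha, hb]⟩

/-- A nonempty set of vertices contains one without predecessors in the set. -/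
lemma exists_minimal_arc [Finite V] (O : Acyc Γ) {s : Set V} (hs : s.Nonempty) :
    ∃ x ∈ s, ∀ a ∈ s, ¬ O.1.Arc a x := by
  have : Std.Irrefl (Relation.TransGen O.1.Arc) := ⟨O.2⟩
  have hwf : WellFounded (Relation.TransGen O.1.Arc) := Finite.wellFounded_of_trans_of_irrefl _
  obtain ⟨x, hx, hmin⟩ := hwf.has_min s hs
  exact ⟨x, hx, fun a ha h => hmin a ha (.single h)⟩

/-- Induction on the total number of clicks. Potentials do not increase along arcs, so a vertex of
maximal potential without predecessors of maximal potential is a source; clicking it uses up one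
unit there. -/
lemma kappaClass_eq_of_nat [Fintype V] (n : ℕ) : ∀ (O O' : Acyc Γ) (h : V → ℤ),
    IsPotential O O' h → (∀ x, 0 ≤ h x) → ∑ x, h x = n → kappaClass O = kappaClass O' := by
  classical
  induction n with
  | zero =>
    intro O O' h H hnn hs
    have h0 : ∀ x, h x = 0 := fun x =>
      (Finset.sum_eq_zero_iff_of_nonneg (fun x _ => hnn x)).1 (by simpa using hs) x
        (Finset.mem_univ x)
    rw [ext_of_arc (O := O) (O' := O')]
    intro a b hab
    rcases H _ _ hab with h₁ | h₁
    · exact h₁.1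
    · have := h₁.2; rw [h0, h0] at this; omega
  | succ n ih =>
    intro O O' h H hnn hs
    have hV : Nonempty V := by
      by_contra hV
      rw [not_nonempty_iff] at hV
      simp at hs
      omega
    obtain ⟨m, hm⟩ := Finite.exists_max h
    have hpos : 0 < h m := by
      by_contra hneg
      have : ∑ x, h x ≤ 0 := Finset.sum_nonpos fun x _ => (hm x).trans (by omega)
      omega
    obtain ⟨x, hx, hmin⟩ := exists_minimal_arc O (s := {x | h x = h m}) ⟨m, rfl⟩
    have hx' : h x = h m := hx
    have hsrc : O.1.IsSource x := by
      intro a ha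
      refine hmin a ?_ ha
      have h₁ := hm a
      change h a = h m
      rcases H _ _ ha with h₂ | h₂ <;> omega
    let P : Acyc Γ := ⟨O.1.reverseAt x, isAcyclic_reverseAt O hsrc⟩
    have hP : IsClick O P := ⟨x, hsrc, rfl⟩
    have e : kappaClass O = kappaClass P := Quotient.sound (Relation.EqvGen.rel _ _ hP)
    rw [e]
    refine ih P O' (fun y => h y - if y = x then 1 else 0) ?_ ?_ ?_
    · rintro a b (⟨⟨ha, hb⟩, hab⟩ | ⟨hx, hab⟩)
      · simpa [ha, hb] using H _ _ hab
      · have hax : a ≠ x := fun h => hsrc b (h ▸ hab)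
        have hbx : b = x := hx.resolve_left hax
        rcases H _ _ hab with h₁ | h₁
        · exact Or.inr ⟨h₁.1, by simp only [hax, hbx, if_true, if_false]; rw [hbx] at h₁; omega⟩
        · exact Or.inl ⟨h₁.1, by simp only [hax, hbx, if_true, if_false]; rw [hbx] at h₁; omega⟩
    · intro y
      have := hnn y
      by_cases hy : y = x
      · subst hy; simp; omega
      · simpa [hy] using this
    · rw [Finset.sum_sub_distrib, hs]
      simp

/-- Two acyclic orientations are `κ`-equivalent exactly when they differ by a potential. -/
theorem kappaClass_eq_iff [Finite V] {O O' : Acyc Γ} :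
    kappaClass O = kappaClass O' ↔ ∃ h, IsPotential O O' h := by
  constructor
  · intro h
    have h' : Relation.EqvGen IsClick O O' := Quotient.exact h
    clear h
    induction h' with
    | rel _ _ h => exact isPotential_of_isClick h
    | refl => exact ⟨_, .refl _⟩
    | symm _ _ _ ih =>
      obtain ⟨h, H⟩ := ih
      exact ⟨_, H.symm⟩
    | trans _ _ _ _ _ ih₁ ih₂ =>
      obtain ⟨h, H⟩ := ih₁
      obtain ⟨h', H'⟩ := ih₂
      exact ⟨_, H.trans H'⟩
  · rintro ⟨h, H⟩
    have := Fintype.ofFinite V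
    -- Adding a constant keeps a potential a potential, so it may be taken nonnegative.
    obtain ⟨k, hk⟩ : ∃ k : ℤ, ∀ x, 0 ≤ h x + k := by
      rcases isEmpty_or_nonempty V with hV | hV
      · exact ⟨0, fun x => isEmptyElim x⟩
      · obtain ⟨m, hm⟩ := Finite.exists_min h
        exact ⟨-h m, fun x => by have := hm x; omega⟩
    exact kappaClass_eq_of_nat _ O O' _ (H.add_const k) hk
      (Int.toNat_of_nonneg (Finset.sum_nonneg fun x _ => hk x)).symm

lemma IsPotential.antitone {O O' : Acyc Γ} {h : V → ℤ} (H : IsPotential O O' h) {a b : V}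
    (hab : Relation.ReflTransGen O.1.Arc a b) : h b ≤ h a := by
  induction hab with
  | refl => exact le_rfl
  | tail _ h₁ ih => rcases H _ _ h₁ with h₂ | h₂ <;> omega

lemma IsPotential.deleteOrientation {O O' : Acyc Γ} {h : V → ℤ} (H : IsPotential O O' h) (v w : V) :
    IsPotential (deleteOrientation v w O) (deleteOrientation v w O') h := by
  rintro a b ⟨hab, hne⟩
  rcases H _ _ hab with h₁ | h₁
  · exact Or.inl ⟨⟨h₁.1, hne⟩, h₁.2⟩
  · exact Or.inr ⟨⟨h₁.1, by rwa [Sym2.eq_swap]⟩, h₁.2⟩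

variable {v w : V}

lemma mk_eq_iff {a b : V} :
    (Quotient.mk (contractionSetoid v w) a = Quotient.mk (contractionSetoid v w) b) ↔
      a = b ∨ ((a = v ∨ a = w) ∧ (b = v ∨ b = w)) :=
  Quotient.eq

lemma eq_or_eq_of_arc {O : Acyc Γ} (hO : O.1.Arc v w) {a b : V} (hab : O.1.Arc a b)
    (h : Quotient.mk (contractionSetoid v w) a = Quotient.mk (contractionSetoid v w) b) :
    a = v ∧ b = w := by
  have h₁ : ∀ x, ¬ O.1.Arc x x := fun x h => O.1.asymm x x h h
  have h₂ := O.1.asymm _ _ hO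
  rcases mk_eq_iff.1 h with rfl | ⟨rfl | rfl, rfl | rfl⟩
  · exact absurd hab (h₁ _)
  · exact absurd hab (h₁ _)
  · exact ⟨rfl, rfl⟩
  · exact absurd hab h₂
  · exact absurd hab (h₁ _)

/-! ### Vertex orders and their representatives of classes -/

section Orders

variable [Fintype V]

/-- A total order of the vertices can be prescribed by an injective key. -/
lemma exists_vertexOrder {α : Type*} [LinearOrder α] (f : V → α) (hf : Function.Injective f) :
    ∃ π : VertexOrder V, ∀ a b, π a < π b ↔ f a < f b := by
  let _ : LinearOrder V := LinearOrder.lift' f hf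
  let e := Fintype.orderIsoFinOfCardEq V rfl
  exact ⟨e.symm.toEquiv, fun a b => e.symm.lt_iff_lt⟩

lemma val_eq_zero_of_forall {π : VertexOrder V} {v : V} (h : ∀ a, ¬ π a < π v) :
    (π v : ℕ) = 0 := by
  by_contra h0
  have h₁ := h (π.symm ⟨0, by have := (π v).2; omega⟩)
  simp only [Equiv.apply_symm_apply, Fin.lt_def] at h₁
  omega

lemma val_eq_one_of_forall {π : VertexOrder V} {v w : V} (hv : π v < π w)
    (h : ∀ a, π a < π w → a = v) : (π w : ℕ) = 1 := by
  have hn := (π w).2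
  rw [Fin.lt_def] at hv
  by_contra h1
  have h₁ := h (π.symm ⟨0, by omega⟩) (by
    simp only [Equiv.apply_symm_apply, Fin.lt_def]; omega)
  have h₂ := h (π.symm ⟨1, by omega⟩) (by
    simp only [Equiv.apply_symm_apply, Fin.lt_def]; omega)
  have := π.symm.injective (h₁.trans h₂.symm)
  simp at this

lemma lt_of_val_eq_zero {π : VertexOrder V} {v : V} (h : (π v : ℕ) = 0) {a : V} (ha : a ≠ v) :
    π v < π a := by
  have : (π a : ℕ) ≠ π v := fun h => ha (π.injective (Fin.ext h))
  rw [Fin.lt_def]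
  omega

/-- Every acyclic orientation is induced by a total order of the vertices. -/
lemma exists_ofOrder_eq (O : Acyc Γ) : ∃ π : VertexOrder V, ofOrder Γ π = O := by
  -- Acyclicity makes reachability a partial order; any linear extension of it induces `O`.
  have : IsPartialOrder V (Relation.ReflTransGen O.1.Arc) :=
    { refl := fun _ => .refl
      trans := fun _ _ _ => .trans
      antisymm := fun a b h h' => by
        rcases Relation.reflTransGen_iff_eq_or_transGen.1 h with h | h
        · exact h.symm
        · exact absurd (h.trans_left h') (O.2 a) }
  obtain ⟨s, hs, hle⟩ := extend_partialOrder (Relation.ReflTransGen O.1.Arc)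
  classical
  let _ : LinearOrder V :=
    { le := s
      le_refl := hs.refl
      le_trans := hs.trans
      le_antisymm := hs.antisymm
      le_total := hs.total
      toDecidableLE := Classical.decRel _ }
  obtain ⟨π, hπ⟩ := exists_vertexOrder (id : V → V) Function.injective_id
  refine ⟨π, Eq.symm (ext_of_arc (O' := ofOrder Γ π) fun a b hab =>
    ⟨(O.1.adj_iff a b).2 (Or.inl hab), (hπ a b).2 ?_⟩)⟩
  refine lt_of_le_of_ne (hle a b (.single hab)) ?_
  rintro (rfl : a = b)
  exact O.1.asymm a a hab hab

lemma exists_kappaClass_ofOrder_eq (c : KappaClass Γ) :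
    ∃ π : VertexOrder V, kappaClass (ofOrder Γ π) = c := by
  induction c using Quotient.inductionOn with
  | h O =>
    obtain ⟨π, rfl⟩ := exists_ofOrder_eq O
    exact ⟨π, rfl⟩

/-- Moving an initial segment of an acyclic orientation to the end of the order is a sequence of
clicks. -/
lemma exists_rotate (π : VertexOrder V) (D : Set V)
    (hD : ∀ a b, (ofOrder Γ π).1.Arc a b → b ∈ D → a ∈ D) :
    ∃ σ : VertexOrder V, kappaClass (ofOrder Γ σ) = kappaClass (ofOrder Γ π) ∧
      ∀ a b, σ a < σ b ↔ (a ∉ D ∧ b ∈ D) ∨ ((a ∈ D ↔ b ∈ D) ∧ π a < π b) := by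
  classical
  obtain ⟨σ, hσ⟩ := exists_vertexOrder
    (fun x => toLex ((if x ∈ D then 1 else 0 : ℕ), π x)) (fun a b h => by
      have := congrArg (fun x => (ofLex x).2) h
      exact π.injective this)
  have hσ' : ∀ a b, σ a < σ b ↔ (a ∉ D ∧ b ∈ D) ∨ ((a ∈ D ↔ b ∈ D) ∧ π a < π b) := by
    intro a b
    rw [hσ, Prod.Lex.toLex_lt_toLex]
    by_cases ha : a ∈ D <;> by_cases hb : b ∈ D <;> simp [ha, hb]
  -- The indicator of `D` is a potential: each vertex of `D` is clicked once, and by `hD` no arc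
  -- enters `D` from outside.
  refine ⟨σ, (kappaClass_eq_iff.2 ⟨fun x => if x ∈ D then 1 else 0, fun a b hab => ?_⟩).symm, hσ'⟩
  have h₁ := hD a b hab
  have h₂ := hσ' a b
  have h₃ := hσ' b a
  obtain ⟨hadj, hlt⟩ := hab
  by_cases ha : a ∈ D <;> by_cases hb : b ∈ D
  · exact Or.inl ⟨⟨hadj, by tauto⟩, by simp [ha, hb]⟩
  · exact Or.inr ⟨⟨hadj.symm, by tauto⟩, by simp [ha, hb]⟩
  · exact absurd (h₁ hb) ha
  · exact Or.inl ⟨⟨hadj, by tauto⟩, by simp [ha, hb]⟩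

/-- Every `κ`-class is represented by an order starting with a prescribed vertex. -/
lemma exists_ofOrder_first (c : KappaClass Γ) (v : V) :
    ∃ π : VertexOrder V, kappaClass (ofOrder Γ π) = c ∧ (π v : ℕ) = 0 := by
  obtain ⟨π, rfl⟩ := exists_kappaClass_ofOrder_eq c
  obtain ⟨σ, hσ, hlt⟩ := exists_rotate (Γ := Γ) π {x | π x < π v} fun a b hab hb => hab.2.trans hb
  refine ⟨σ, hσ, val_eq_zero_of_forall fun a ha => ?_⟩
  rw [hlt] at ha
  simp only [Set.mem_ofPred_eq, lt_irrefl] at ha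
  tauto

lemma exists_isDistinguished (c : KappaClass Γ) (v w : V) :
    ∃ π, IsDistinguished v w c π := by
  obtain ⟨π, ⟨h₁, h₂⟩, hmin⟩ := WellFounded.has_min (measure fun π : VertexOrder V => (π w : ℕ)).wf
    {π | kappaClass (ofOrder Γ π) = c ∧ (π v : ℕ) = 0} (exists_ofOrder_first c v)
  exact ⟨π, h₁, h₂, fun σ h₃ h₄ => not_lt.1 (hmin σ ⟨h₃, h₄⟩)⟩

lemma IsDistinguished.val_eq_one {c : KappaClass Γ} {π : VertexOrder V}
    (hvw : v ≠ w) (h : IsDistinguished v w c π) (hc : HasConsecutive v w c) :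
    (π w : ℕ) = 1 := by
  obtain ⟨σ, h₁, h₂, h₃⟩ := hc
  have h₄ := h.2.2 σ h₁ h₂
  have h₅ := lt_of_val_eq_zero h.2.1 hvw.symm
  rw [Fin.lt_def] at h₅
  rw [Fin.le_def] at h₄
  omega

/-! ### The deletion -/

lemma arc_of_first (hadj : Γ.Adj v w) {π : VertexOrder V} (h : (π v : ℕ) = 0) :
    (ofOrder Γ π).1.Arc v w :=
  ⟨hadj, lt_of_val_eq_zero h hadj.ne'⟩

lemma kappaClass_deleteOrientation_eq {O O' : Acyc Γ} (v w : V)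
    (h : kappaClass O = kappaClass O') :
    kappaClass (deleteOrientation v w O) = kappaClass (deleteOrientation v w O') := by
  obtain ⟨h, H⟩ := kappaClass_eq_iff.1 h
  exact kappaClass_eq_iff.2 ⟨h, H.deleteOrientation v w⟩

lemma deleteOrientation_ofOrder (v w : V) (π : VertexOrder V) :
    deleteOrientation v w (ofOrder Γ π) = ofOrder (deletion Γ v w) π := by
  refine ext_of_arc fun a b h => ⟨?_, h.1.2⟩
  rw [SimpleGraph.deleteEdges_adj]
  exact ⟨h.1.1, h.2⟩

/-- A potential on the deletion lifts to one on the graph when both orientations contain a directed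
path from `v` to `w` besides the arc `(v, w)`. -/
lemma kappaClass_eq_of_deleteOrientation {O O' : Acyc Γ} (hO : O.1.Arc v w) (hO' : O'.1.Arc v w)
    (hp : Relation.ReflTransGen (deleteOrientation v w O).1.Arc v w)
    (hp' : Relation.ReflTransGen (deleteOrientation v w O').1.Arc v w)
    (h : kappaClass (deleteOrientation v w O) = kappaClass (deleteOrientation v w O')) :
    kappaClass O = kappaClass O' := by
  obtain ⟨h, H⟩ := kappaClass_eq_iff.1 h
  have hvw : h v = h w := by
    have h₁ := H.antitone hp
    have h₂ := H.symm.antitone hp'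
    simp only [Pi.neg_apply] at h₂
    omega
  refine kappaClass_eq_iff.2 ⟨h, fun a b hab => ?_⟩
  by_cases he : s(a, b) = s(v, w)
  · rcases Sym2.eq_iff.1 he with ⟨rfl, rfl⟩ | ⟨rfl, rfl⟩
    · exact Or.inl ⟨hO', hvw⟩
    · exact absurd hab (O.1.asymm _ _ hO)
  · rcases H a b ⟨hab, he⟩ with h₁ | h₁
    · exact Or.inl ⟨h₁.1.1, h₁.2⟩
    · exact Or.inr ⟨h₁.1.1, h₁.2⟩

/-- Without such a path, `v` is not among the proper ancestors of `w` in the deletion. Clicking all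
these ancestors once moves them to the end, and `w` can then come right after `v`. -/
lemma exists_path_of_not_hasConsecutive (hadj : Γ.Adj v w) {π : VertexOrder V}
    (hv : (π v : ℕ) = 0) (hc : ¬ HasConsecutive v w (kappaClass (ofOrder Γ π))) :
    Relation.ReflTransGen (deleteOrientation v w (ofOrder Γ π)).1.Arc v w := by
  classical
  by_contra hp
  apply hc
  set R := (deleteOrientation v w (ofOrder Γ π)).1.Arc with hR
  let D : Set V := {x | Relation.ReflTransGen R x w ∧ x ≠ w}
  have hvD : v ∉ D := fun h => hp h.1
  have hwD : w ∉ D := fun h => h.2 rfl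
  have hvw := hadj.ne
  -- Blocks of the new order: `v`, then `w`, then the remaining vertices, then `D`; inside a block
  -- the order of `π` is kept.
  obtain ⟨σ, hσ⟩ := exists_vertexOrder
    (fun x => toLex ((if x = v then 0 else if x = w then 1 else if x ∈ D then 3 else 2 : ℕ), π x))
    (fun a b h => by
      have := congrArg (fun x => (ofLex x).2) h
      exact π.injective this)
  simp only [Prod.Lex.toLex_lt_toLex] at hσ
  have hσv : (σ v : ℕ) = 0 := by
    refine val_eq_zero_of_forall fun a ha => ?_
    rw [hσ, if_pos rfl] at ha
    rcases ha with ha | ⟨h₁, h₂⟩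
    · simp at ha
    · have : a = v := by
        by_contra hav
        rw [if_neg hav] at h₁
        split_ifs at h₁
      exact lt_irrefl _ (this ▸ h₂)
  have hσvw : σ v < σ w := lt_of_val_eq_zero hσv hvw.symm
  have hσw : ∀ a, a ≠ v → a ≠ w → σ w < σ a := by
    intro a h₁ h₂
    rw [hσ]
    left
    simp only [if_neg h₁, if_neg h₂, if_neg hvw.symm, if_true]
    split_ifs <;> omega
  refine ⟨σ, ?_, hσv, val_eq_one_of_forall hσvw fun a ha => ?_⟩
  · refine (kappaClass_eq_iff.2 ⟨fun x => if x ∈ D then 1 else 0, fun a b hab => ?_⟩).symm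
    obtain ⟨hab', hlt⟩ := id hab
    have hbv : b ≠ v := by
      rintro rfl
      rw [Fin.lt_def] at hlt
      omega
    by_cases ha : a ∈ D
    · have hav : a ≠ v := fun h => hvD (h ▸ ha)
      by_cases hb : b ∈ D
      · refine Or.inl ⟨⟨hab', ?_⟩, by simp [ha, hb]⟩
        rw [hσ]
        simp [hav, ha.2, hbv, hb.2, ha, hb, hlt]
      · refine Or.inr ⟨⟨hab'.symm, ?_⟩, by simp [ha, hb]⟩
        by_cases hbw : b = w
        · exact hbw ▸ hσw a hav ha.2
        · rw [hσ]
          simp [hav, ha.2, hbv, hbw, ha, hb]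
    · have hbD : b ∉ D := by
        intro hb
        have hne : s(a, b) ≠ s(v, w) := by
          rw [Ne, Sym2.eq_iff]
          rintro (⟨-, h⟩ | ⟨-, h⟩)
          · exact hb.2 h
          · exact hbv h
        have hab'' : R a b := ⟨hab, hne⟩
        by_cases haw : a = w
        · subst haw
          exact (deleteOrientation v a (ofOrder Γ π)).2 a
            (Relation.TransGen.head' hab'' hb.1)
        · exact ha ⟨.head hab'' hb.1, haw⟩
      refine Or.inl ⟨⟨hab', ?_⟩, by simp [ha, hbD]⟩
      by_cases hav : a = v
      · exact hav ▸ lt_of_val_eq_zero hσv hbv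
      by_cases haw : a = w
      · exact haw ▸ hσw b hbv (haw ▸ hab'.ne')
      by_cases hbw : b = w
      · subst hbw
        refine absurd ⟨.single ⟨hab, ?_⟩, haw⟩ ha
        rw [Ne, Sym2.eq_iff]
        rintro (⟨h, -⟩ | ⟨h, -⟩)
        · exact hav h
        · exact haw h
      · rw [hσ]
        simp [hav, haw, hbv, hbw, ha, hbD, hlt]
  · by_contra hav
    by_cases haw : a = w
    · exact lt_irrefl _ (haw ▸ ha)
    · exact lt_asymm ha (hσw a hav haw)

/-- Let `a` precede `w` on the path, so `a ≠ v`. In passing to an order `v w ⋯` the potential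
satisfies `h a ≤ h v = h w`, so the arc `(a, w)` is kept, and `a` would have to lie strictly between
`v` and `w`. -/
lemma not_hasConsecutive_of_path (hadj : Γ.Adj v w) {O : Acyc Γ} (hO : O.1.Arc v w)
    (hp : Relation.ReflTransGen (deleteOrientation v w O).1.Arc v w) :
    ¬ HasConsecutive v w (kappaClass O) := by
  rintro ⟨π, hπ, hv, hw⟩
  obtain ⟨h, H⟩ := kappaClass_eq_iff.1 hπ.symm
  have hvw : h v = h w := by
    rcases H _ _ hO with h₁ | h₁
    · exact h₁.2
    · exact absurd h₁.1 ((ofOrder Γ π).1.asymm _ _ (arc_of_first hadj hv))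
  rcases Relation.ReflTransGen.cases_tail hp with h₁ | ⟨a, h₁, h₂, h₃⟩
  · exact hadj.ne h₁.symm
  · have hle := (H.deleteOrientation v w).antitone h₁
    have hav : a ≠ v := fun h => h₃ (by rw [h])
    rcases H _ _ h₂ with h₄ | h₄
    · have h₅ : π a < π w := h₄.1.2
      have h₆ := lt_of_val_eq_zero hv hav
      rw [Fin.lt_def] at h₅ h₆
      omega
    · omega

/-- Every `κ`-class contains an orientation in which all of the component of `v` can be reached
from `v` along arcs. -/
lemma exists_reachable_along_arcs (d : KappaClass Γ) (v : V) :
    ∃ π : VertexOrder V, kappaClass (ofOrder Γ π) = d ∧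
      ∀ x, Γ.Reachable v x → Relation.ReflTransGen (ofOrder Γ π).1.Arc v x := by
  classical
  let S : VertexOrder V → Set V := fun π => {x | Relation.ReflTransGen (ofOrder Γ π).1.Arc v x}
  obtain ⟨π, hπ, hmax⟩ := Set.exists_max_image
    {π : VertexOrder V | kappaClass (ofOrder Γ π) = d} (fun π => (S π).ncard) (Set.toFinite _)
    (exists_kappaClass_ofOrder_eq d)
  -- Edges between the reachable set and its complement point into the reachable set. Clicking the
  -- complement turns them outwards, so by maximality there are none.
  obtain ⟨σ, hσ, hlt⟩ := exists_rotate (Γ := Γ) π (S π)ᶜ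
    fun a b hab hb ha => hb (Relation.ReflTransGen.tail ha hab)
  have hsub : S π ⊆ S σ := by
    intro x hx
    change Relation.ReflTransGen _ v x at hx
    induction hx with
    | refl => exact Relation.ReflTransGen.refl
    | @tail b c h₁ h₂ ih =>
      refine Relation.ReflTransGen.tail ih ⟨h₂.1, (hlt _ _).2 (Or.inr ⟨?_, h₂.2⟩)⟩
      have hb : b ∈ S π := h₁
      have hc : c ∈ S π := h₁.tail h₂
      simp [hb, hc]
  have heq : S π = S σ :=
    Set.eq_of_subset_of_ncard_le hsub (hmax σ (hσ.trans hπ)) (Set.toFinite _)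
  have hclosed : ∀ a b, Γ.Adj a b → a ∈ S π → b ∈ S π := by
    intro a b hab ha
    by_contra hb
    have : b ∈ S σ :=
      Relation.ReflTransGen.tail (hsub ha) ⟨hab, (hlt _ _).2 (Or.inl (by simp [ha, hb]))⟩
    exact hb (heq ▸ this)
  refine ⟨π, hπ, fun x hx => ?_⟩
  rw [SimpleGraph.reachable_iff_reflTransGen] at hx
  change x ∈ S π
  induction hx with
  | refl => exact Relation.ReflTransGen.refl
  | tail _ h ih => exact hclosed _ _ h ih

/-! ### The contraction -/

/-- Pulling back along the quotient map turns potentials on the contraction into potentials on `Γ`;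
conversely the common arc `(v, w)` forces `h v = h w`, so `h` descends. -/
lemma kappaClass_contraction_eq_iff {O O' : Acyc Γ} (hO : O.1.Arc v w) (hO' : O'.1.Arc v w)
    {P P' : Acyc (contraction Γ v w)} (hP : IsContractionOf P O) (hP' : IsContractionOf P' O') :
    kappaClass P = kappaClass P' ↔ kappaClass O = kappaClass O' := by
  rw [kappaClass_eq_iff, kappaClass_eq_iff]
  constructor
  · rintro ⟨h, H⟩
    refine ⟨fun x => h (Quotient.mk _ x), fun a b hab => ?_⟩
    by_cases he : Quotient.mk (contractionSetoid v w) a = Quotient.mk (contractionSetoid v w) b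
    · obtain ⟨rfl, rfl⟩ := eq_or_eq_of_arc hO hab he
      exact Or.inl ⟨hO', congrArg h he⟩
    · have h₁ := H _ _ ((hP _ _).2 ⟨he, a, b, rfl, rfl, hab⟩)
      rcases h₁ with ⟨h₁, e⟩ | ⟨h₁, e⟩ <;> rcases arc_or_arc O O' hab with h₂ | h₂
      · exact Or.inl ⟨h₂, e⟩
      · exact absurd ((hP' _ _).2 ⟨Ne.symm he, b, a, rfl, rfl, h₂⟩) (P'.1.asymm _ _ h₁)
      · exact absurd ((hP' _ _).2 ⟨he, a, b, rfl, rfl, h₂⟩) (P'.1.asymm _ _ h₁)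
      · exact Or.inr ⟨h₂, e⟩
  · rintro ⟨h, H⟩
    have hvw : h v = h w := by
      rcases H _ _ hO with h₁ | h₁
      · exact h₁.2
      · exact absurd h₁.1 (O'.1.asymm _ _ hO')
    refine ⟨Quotient.lift h fun a b hab => ?_, fun A B hAB => ?_⟩
    · rcases hab with rfl | ⟨rfl | rfl, rfl | rfl⟩ <;> simp [hvw]
    · obtain ⟨hne, a, b, rfl, rfl, hab⟩ := (hP _ _).1 hAB
      rcases H _ _ hab with h₁ | h₁
      · exact Or.inl ⟨(hP' _ _).2 ⟨hne, a, b, rfl, rfl, h₁.1⟩, h₁.2⟩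
      · exact Or.inr ⟨(hP' _ _).2 ⟨hne.symm, b, a, rfl, rfl, h₁.1⟩, h₁.2⟩

/-- An order of the contraction and an order of the vertices compatible with it induce matching
orientations. -/
lemma isContractionOf_ofOrder [Fintype (ContractionVertex v w)]
    {τ : VertexOrder (ContractionVertex v w)} {π : VertexOrder V}
    (h : ∀ a b, Quotient.mk (contractionSetoid v w) a ≠ Quotient.mk (contractionSetoid v w) b →
      (τ (Quotient.mk _ a) < τ (Quotient.mk _ b) ↔ π a < π b)) :
    IsContractionOf (ofOrder (contraction Γ v w) τ) (ofOrder Γ π) := by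
  intro A B
  constructor
  · rintro ⟨⟨hne, a, b, rfl, rfl, hab⟩, hlt⟩
    exact ⟨hne, a, b, rfl, rfl, hab, (h a b hne).1 hlt⟩
  · rintro ⟨hne, a, b, rfl, rfl, hab, hlt⟩
    exact ⟨⟨hne, a, b, rfl, rfl, hab⟩, (h a b hne).2 hlt⟩

lemma exists_isContractionOf {π : VertexOrder V} (hv : (π v : ℕ) = 0) (hw : (π w : ℕ) = 1) :
    ∃ P : Acyc (contraction Γ v w), IsContractionOf P (ofOrder Γ π) := by
  classical
  have := Fintype.ofFinite (ContractionVertex v w)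
  have hinj : ∀ {a b : V}, (π a : ℕ) = π b → a = b := fun h => π.injective (Fin.ext h)
  -- Truncated subtraction sends positions 0 and 1 both to 0, so `g` merges exactly `v` and `w`.
  let g : V → ℕ := fun x => (π x : ℕ) - 1
  have hg : ∀ a b, g a = g b ↔
      Quotient.mk (contractionSetoid v w) a = Quotient.mk (contractionSetoid v w) b := by
    intro a b
    rw [mk_eq_iff]
    have h₀ : ∀ x, (π x : ℕ) = 0 → x = v := fun x h => hinj (h.trans hv.symm)
    have h₁ : ∀ x, (π x : ℕ) = 1 → x = w := fun x h => hinj (h.trans hw.symm)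
    constructor
    · intro h
      change (π a : ℕ) - 1 = π b - 1 at h
      by_cases hab : (π a : ℕ) = π b
      · exact Or.inl (hinj hab)
      · right
        have ha : (π a : ℕ) = 0 ∨ (π a : ℕ) = 1 := by omega
        have hb : (π b : ℕ) = 0 ∨ (π b : ℕ) = 1 := by omega
        exact ⟨ha.imp (h₀ a) (h₁ a), hb.imp (h₀ b) (h₁ b)⟩
    · rintro (rfl | ⟨rfl | rfl, rfl | rfl⟩) <;> simp [g, hv, hw]
  obtain ⟨τ, hτ⟩ := exists_vertexOrder
    (Quotient.lift g fun a b hab => (hg a b).2 (Quotient.sound hab)) (by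
      rintro ⟨a⟩ ⟨b⟩ h
      exact (hg a b).1 h)
  refine ⟨ofOrder _ τ, isContractionOf_ofOrder fun a b hne => ?_⟩
  rw [hτ, Fin.lt_def]
  have h₁ : (π a : ℕ) - 1 ≠ π b - 1 := fun h => hne ((hg a b).1 h)
  change (π a : ℕ) - 1 < π b - 1 ↔ _
  omega

/-- Every class of the contraction is induced by an order starting with `v`, `w`. -/
lemma exists_consecutive_isContractionOf (hvw : v ≠ w) (d : KappaClass (contraction Γ v w)) :
    ∃ (π : VertexOrder V) (P : Acyc (contraction Γ v w)), (π v : ℕ) = 0 ∧ (π w : ℕ) = 1 ∧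
      IsContractionOf P (ofOrder Γ π) ∧ kappaClass P = d := by
  classical
  have := Fintype.ofFinite (ContractionVertex v w)
  obtain ⟨τ, hτ, h0⟩ := exists_ofOrder_first d (Quotient.mk _ v)
  have hwv : Quotient.mk (contractionSetoid v w) w = Quotient.mk (contractionSetoid v w) v :=
    mk_eq_iff.2 (by tauto)
  -- The merged vertex, first in `τ`, is expanded to `v` followed by `w`; the second key only breaks
  -- this tie.
  obtain ⟨π, hπ⟩ := exists_vertexOrder
    (fun x => toLex (τ (Quotient.mk _ x), (if x = w then 1 else 0 : ℕ))) (fun a b h => by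
      have h₁ := τ.injective (congrArg (fun x => (ofLex x).1) h)
      have h₂ : (if a = w then 1 else 0 : ℕ) = if b = w then 1 else 0 :=
        congrArg (fun x => (ofLex x).2) h
      rcases mk_eq_iff.1 h₁ with h₃ | ⟨rfl | rfl, rfl | rfl⟩
      · exact h₃
      · rfl
      · simp [hvw] at h₂
      · simp [hvw] at h₂
      · rfl)
  simp only [Prod.Lex.toLex_lt_toLex] at hπ
  have hlt : ∀ a, a ≠ v → a ≠ w → τ (Quotient.mk _ v) < τ (Quotient.mk _ a) := fun a h₁ h₂ =>
    lt_of_val_eq_zero h0 fun h => by rcases mk_eq_iff.1 h with h | ⟨h | h, -⟩ <;> tauto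
  have hlast : π v < π w := by rw [hπ]; simp [hwv, hvw]
  refine ⟨π, ofOrder _ τ, val_eq_zero_of_forall fun a ha => ?_,
    val_eq_one_of_forall hlast fun a ha => ?_, isContractionOf_ofOrder fun a b hne => ?_, hτ⟩
  · by_cases hav : a = v
    · exact lt_irrefl _ (hav ▸ ha)
    by_cases haw : a = w
    · exact lt_asymm hlast (haw ▸ ha)
    · exact lt_asymm ha ((hπ _ _).2 (Or.inl (hlt a hav haw)))
  · by_contra hav
    by_cases haw : a = w
    · exact lt_irrefl _ (haw ▸ ha)
    · exact lt_asymm ha ((hπ _ _).2 (Or.inl (hwv ▸ hlt a hav haw)))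
  · rw [hπ]
    have : τ (Quotient.mk _ a) ≠ τ (Quotient.mk _ b) := fun h => hne (τ.injective h)
    simp [this]

/-! ### The values of `Θ` -/

lemma exists_isThetaValue (hvw : v ≠ w) (c : KappaClass Γ) : ∃ d, IsThetaValue v w c d := by
  obtain ⟨π, hπ⟩ := exists_isDistinguished c v w
  by_cases hc : HasConsecutive v w c
  · obtain ⟨P, hP⟩ := exists_isContractionOf (Γ := Γ) hπ.2.1 (hπ.val_eq_one hvw hc)
    exact ⟨_, π, hπ, Or.inl ⟨hc, P, hP, rfl⟩⟩
  · exact ⟨_, π, hπ, Or.inr ⟨hc, rfl⟩⟩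

lemma IsThetaValue.unique (hadj : Γ.Adj v w) {c : KappaClass Γ}
    {d d' : KappaClass (deletion Γ v w) ⊕ KappaClass (contraction Γ v w)}
    (h : IsThetaValue v w c d) (h' : IsThetaValue v w c d') : d = d' := by
  obtain ⟨π, hπ, h⟩ := h
  obtain ⟨σ, hσ, h'⟩ := h'
  rcases h with ⟨hc, P, hP, rfl⟩ | ⟨hc, rfl⟩ <;> rcases h' with ⟨hc', P', hP', rfl⟩ | ⟨hc', rfl⟩
  · rw [(kappaClass_contraction_eq_iff (arc_of_first hadj hπ.2.1) (arc_of_first hadj hσ.2.1)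
      hP hP').2 (hπ.1.trans hσ.1.symm)]
  · exact absurd hc hc'
  · exact absurd hc' hc
  · rw [kappaClass_deleteOrientation_eq v w (hπ.1.trans hσ.1.symm)]

lemma IsThetaValue.injective (hadj : Γ.Adj v w) {c c' : KappaClass Γ}
    {d : KappaClass (deletion Γ v w) ⊕ KappaClass (contraction Γ v w)}
    (h : IsThetaValue v w c d) (h' : IsThetaValue v w c' d) : c = c' := by
  obtain ⟨π, ⟨rfl, hπ, -⟩, h⟩ := h
  obtain ⟨σ, ⟨rfl, hσ, -⟩, h'⟩ := h'
  have ha := arc_of_first hadj hπ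
  have ha' := arc_of_first hadj hσ
  rcases h with ⟨hc, P, hP, rfl⟩ | ⟨hc, rfl⟩ <;> rcases h' with ⟨hc', P', hP', e⟩ | ⟨hc', e⟩
  · exact (kappaClass_contraction_eq_iff ha ha' hP hP').1 (Sum.inr_injective e)
  · exact absurd e (by simp)
  · exact absurd e (by simp)
  · exact kappaClass_eq_of_deleteOrientation ha ha' (exists_path_of_not_hasConsecutive hadj hπ hc)
      (exists_path_of_not_hasConsecutive hadj hσ hc') (Sum.inl_injective e)

/-- That the edge is not a bridge enters here: it makes `w` reachable from `v` in the deletion. -/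
lemma exists_isThetaValue_eq (he : IsCycleEdge Γ v w)
    (d : KappaClass (deletion Γ v w) ⊕ KappaClass (contraction Γ v w)) :
    ∃ c, IsThetaValue v w c d := by
  obtain ⟨hadj, hb⟩ := he
  rcases d with d | d
  · obtain ⟨π, rfl, hreach⟩ := exists_reachable_along_arcs d v
    have hp := hreach w (by
      rw [SimpleGraph.isBridge_iff] at hb
      tauto)
    rw [← deleteOrientation_ofOrder] at hp
    -- The arc `(w, v)` would close the path from `v` to `w` into a directed cycle.
    have hvw : (ofOrder Γ π).1.Arc v w := by
      rcases ((ofOrder Γ π).1.adj_iff v w).1 hadj with h | h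
      · exact h
      · exact absurd (Relation.TransGen.tail' (Relation.ReflTransGen.mono (fun _ _ h => h.1) _ _ hp) h) ((ofOrder Γ π).2 v)
    obtain ⟨σ, hσ⟩ := exists_isDistinguished (kappaClass (ofOrder Γ π)) v w
    refine ⟨_, σ, hσ, Or.inr ⟨not_hasConsecutive_of_path hadj hvw hp, ?_⟩⟩
    rw [kappaClass_deleteOrientation_eq v w hσ.1, deleteOrientation_ofOrder]
  · obtain ⟨π, P, hv, hw, hP, rfl⟩ := exists_consecutive_isContractionOf hadj.ne d
    refine ⟨_, π, ⟨rfl, hv, fun σ _ hσ => ?_⟩, Or.inl ⟨⟨π, rfl, hv, hw⟩, P, hP, rfl⟩⟩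
    -- With `v` at position 0, `w` is at position at least 1, so `π` is minimal.
    have := lt_of_val_eq_zero hσ hadj.ne'
    rw [Fin.lt_def] at this
    rw [Fin.le_def]
    omega

end Orders

end ClickBijection

theorem theorem1 {V : Type*} [Fintype V] (Γ : SimpleGraph V) (hΓ : Γ.Connected) (v w : V)
    (he : ClickBijection.IsCycleEdge Γ v w) :
    ∃ Θ : ClickBijection.KappaClass Γ →
        ClickBijection.KappaClass (ClickBijection.deletion Γ v w) ⊕
          ClickBijection.KappaClass (ClickBijection.contraction Γ v w),
      (∀ c d, ClickBijection.IsThetaValue v w c d ↔ Θ c = d) ∧ Function.Bijective Θ := by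
  choose Θ hΘ using ClickBijection.exists_isThetaValue (Γ := Γ) he.1.ne
  refine ⟨Θ, fun c d => ⟨fun h => (hΘ c).unique he.1 h, fun h => h ▸ hΘ c⟩, fun c c' h => ?_,
    fun d => ?_⟩
  · exact (hΘ c).injective he.1 (h ▸ hΘ c')
  · obtain ⟨c, hc⟩ := ClickBijection.exists_isThetaValue_eq he d
    exact ⟨c, (hΘ c).unique he.1 hc⟩
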